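/- All graphs are finite and simple. For a graph $G$ write $\mathrm{Aut}(G)$ for its automorphism group and $\alpha^*(G)$ for its fractional independence number, i.e. the maximum of $\sum_{v\in V(G)}\alpha(v)$ over all $\alpha\colon V(G)\to[0,1]$ with $\alpha(u)+\alpha(v)\le 1$ for every edge $uv$ of $G$. Let $\mathrm{eind}(G,m)$ be the maximum, over all graphs $H$ with exactly $m$ edges, of the number of induced copies of $G$ in $H$ (sets $S\subseteq V(H)$ with $H[S]\cong G$). For $G$ without isolated vertices, the edge inducibility of $G$ is $$\mathrm{eind}(G)=\limsup_{m\to\infty}\frac{|\mathrm{Aut}(G)|\,\mathrm{eind}(G,m)}{(2m)^{\alpha^*(G)}}.$$ A fractional perfect matching of $G$ is a function $w\colon E(G)\to[0,1]$ with $\sum_{u:\,uv\in E(G)}w(uv)=1$ for every $v\in V(G)$; a perfect matching is identified with its indicator function. **Theorem.** (i) Let $G$ be a graph with a perfect matching $M$ of size $k\neq 1$ that is the unique fractional perfect matching of $G$. Then $$\mathrm{eind}(G)\ \ge\ \frac{|\mathrm{Aut}(G)|}{2^k\,(k^k-k)},$$ where $0^0=1$. (ii) For every integer $t\ge 2$,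 the path $P_{2t}$ on $2t$ vertices satisfies $$\mathrm{eind}(P_{2t})\ \ge\ \frac{1}{2^{t-1}(t^t-t)}.$$ -/

import Mathlib

namespace EdgeInducibility

/-- `α : V(G) → [0,1]` is a fractional independent set of `G`:
`α u + α v ≤ 1` for every edge `uv`. -/
def IsFractionalIndepSet {V : Type*} (G : SimpleGraph V) (α : V → ℝ) : Prop :=
  (∀ v, 0 ≤ α v ∧ α v ≤ 1) ∧ ∀ u v, G.Adj u v → α u + α v ≤ 1

/-- The fractional independence number `α*(G)`: the largest total weight of a fractional
independent set. (The set below is nonempty, since `α = 0` is allowed, and bounded by `|V|`.) -/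
noncomputable def fracIndepNum {V : Type*} [Fintype V] (G : SimpleGraph V) : ℝ :=
  sSup {x : ℝ | ∃ α : V → ℝ, IsFractionalIndepSet G α ∧ x = ∑ v, α v}

open Classical in
/-- `w : E(G) → [0,1]` is a fractional perfect matching of `G`: at every vertex the weights of
the incident edges sum to `1`. -/
def IsFractionalPerfectMatching {V : Type*} [Fintype V] (G : SimpleGraph V)
    (w : G.edgeSet → ℝ) : Prop :=
  (∀ e, 0 ≤ w e ∧ w e ≤ 1) ∧
    ∀ v : V, ∑ u : G.neighborSet v, w ⟨s(v, (u : V)), G.mem_edgeSet.2 u.2⟩ = 1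

open Classical in
/-- The weight function on the edges of `G` that is `1` on the edges of `M` and `0` elsewhere. -/
noncomputable def edgeIndicator {V : Type*} {G : SimpleGraph V} (M : G.Subgraph) :
    G.edgeSet → ℝ :=
  fun e => if (e : Sym2 V) ∈ M.edgeSet then 1 else 0

/-- `M` is a perfect matching of `G` and (its indicator function) is the only fractional perfect
matching of `G`. -/
def IsUniqueFractionalPerfectMatching {V : Type*} [Fintype V] (G : SimpleGraph V)
    (M : G.Subgraph) : Prop :=
  M.IsPerfectMatching ∧
    ∀ w : G.edgeSet → ℝ, IsFractionalPerfectMatching G w ↔ w = edgeIndicator M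

/-- `N_ind(G, H)`, the number of induced copies of `G` in `H`: the number of vertex sets `S` of
`H` for which the induced graph `H[S]` is isomorphic to `G`. -/
noncomputable def inducedCount {V W : Type*} (G : SimpleGraph V) (H : SimpleGraph W) : ℕ :=
  {S : Set W | Nonempty (H.induce S ≃g G)}.ncard

/-- `eind(G, m)`, the maximum of `N_ind(G, H)` over all finite graphs `H` with exactly `m` edges
(and any number of vertices). For `G` without isolated vertices the set below is bounded. -/
noncomputable def eindEdges {V : Type*} (G : SimpleGraph V) (m : ℕ) : ℕ :=
  sSup {N : ℕ | ∃ (n : ℕ) (H : SimpleGraph (Fin n)),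
    H.edgeSet.ncard = m ∧ N = inducedCount G H}

/-- The edge inducibility
`eind(G) = limsup_{m → ∞} |Aut G| * eind(G, m) / (2m)^{α*(G)}` of a finite graph `G` without
isolated vertices (for such `G` the sequence takes values in `[0, 1]`). -/
noncomputable def eind {V : Type*} [Fintype V] (G : SimpleGraph V) : ℝ :=
  Filter.limsup
    (fun m : ℕ =>
      (Nat.card (G ≃g G) : ℝ) * (eindEdges G m : ℝ) / (2 * (m : ℝ)) ^ fracIndepNum G)
    Filter.atTop

end EdgeInducibility

namespace EdgeInducibility

universe u

/-! If `M` is the only fractional perfect matching, no closed walk alternates between edges outside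
`M` and edges of `M`: shifting weight along it would give a second fractional perfect matching
(`not_transGen`). A height function for alternating steps then yields natural vertex weights for
which all matching edges have the same total `D` and all other edges less
(`exists_isWeightedPairing`).

Given such weights on a template `T` with total `E`, replace each vertex `w` by `n ^ q w`
independent vertices. Each matching edge becomes `n ^ E` edges and all others together contribute
only `O(n ^ (E - 1))`, whereas each copy of `G` made of `k` matching pairs of `T` yields `n ^ (E *
k)` induced copies.

The templates come from iterated substitution of `G` into its own matching edges, the weights being
combined lexicographically. At depth `d` there are `k ^ d` pairs and `c_d` copies, with `c_(d+1) = k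
* c_d + (k ^ d) ^ k`. Since the fractional independence number is `k`, this gives at least `|Aut G|
* c_d / (2 * k ^ d) ^ k` (`le_eind_of_family`), and `c_d / (k ^ d) ^ k` tends to `1 / (k ^ k - k)`.
Paths carry explicit weights. -/

/-! ### Weighted pairings and substitution -/

/-- The pairs `(i, false), (i, true)` are edges of `G` of total weight `D` with the heavier
end marked `true`, and every other edge has total weight less than `D`. -/
structure IsWeightedPairing {I : Type*} (G : SimpleGraph (I × Bool)) (p : I × Bool → ℕ)
    (D : ℕ) : Prop where
  pos : 0 < D
  adj : ∀ i, G.Adj (i, false) (i, true)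
  le : ∀ i, p (i, false) ≤ p (i, true)
  add_eq : ∀ i, p (i, false) + p (i, true) = D
  add_lt : ∀ u v, G.Adj u v → u.1 ≠ v.1 → p u + p v < D

theorem IsWeightedPairing.weight_le {I : Type*} {G : SimpleGraph (I × Bool)} {p : I × Bool → ℕ}
    {D : ℕ} (h : IsWeightedPairing G p D) (v : I × Bool) : p v ≤ D := by
  obtain ⟨i, s⟩ := v
  have := h.add_eq i
  cases s <;> omega

theorem IsWeightedPairing.adj_iff {I : Type*} {G : SimpleGraph (I × Bool)} {p : I × Bool → ℕ}
    {D : ℕ} (h : IsWeightedPairing G p D) (i : I) (s t : Bool) :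
    G.Adj (i, s) (i, t) ↔ s ≠ t := by
  have h1 := h.adj i
  have h2 := h1.symm
  cases s <;> cases t <;> simp [h1, h2]

/-- The graph obtained from `G` by replacing every pair `(i, false), (i, true)` by a copy of
`T`. -/
def substGraph {I Λ : Type*} (G : SimpleGraph (I × Bool)) (T : SimpleGraph (Λ × Bool)) :
    SimpleGraph ((I × Λ) × Bool) where
  Adj u v := (u.1.1 = v.1.1 ∧ T.Adj (u.1.2, u.2) (v.1.2, v.2)) ∨
    (u.1.1 ≠ v.1.1 ∧ G.Adj (u.1.1, u.2) (v.1.1, v.2))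
  symm := ⟨by
    rintro u v (⟨h, h'⟩ | ⟨h, h'⟩)
    · exact Or.inl ⟨h.symm, h'.symm⟩
    · exact Or.inr ⟨h.symm, h'.symm⟩⟩
  loopless := ⟨by
    rintro u (⟨-, h'⟩ | ⟨h, -⟩)
    · exact h'.ne rfl
    · exact h rfl⟩

/-- The factor `E + 1` makes the outer weight dominate: a deficit of `1` in the outer sum outweighs
the inner sum, which is at most `2 * E`. -/
theorem IsWeightedPairing.subst {I Λ : Type*} {G : SimpleGraph (I × Bool)}
    {T : SimpleGraph (Λ × Bool)} {p : I × Bool → ℕ} {q : Λ × Bool → ℕ} {D E : ℕ}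
    (hG : IsWeightedPairing G p D) (hT : IsWeightedPairing T q E) :
    IsWeightedPairing (substGraph G T)
      (fun u => (E + 1) * p (u.1.1, u.2) + q (u.1.2, u.2)) ((E + 1) * D + E) where
  pos := by have := hT.pos; omega
  adj i := Or.inl ⟨rfl, hT.adj i.2⟩
  le i := by
    have h1 := Nat.mul_le_mul_left (E + 1) (hG.le i.1)
    have h2 := hT.le i.2
    simp only
    omega
  add_eq i := by
    have h1 := hG.add_eq i.1
    have h2 := hT.add_eq i.2
    simp only
    rw [← h1, Nat.mul_add]
    omega
  add_lt u v huv hne := by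
    obtain ⟨⟨i, a⟩, s⟩ := u
    obtain ⟨⟨j, b⟩, t⟩ := v
    simp only
    rcases huv with ⟨h, h'⟩ | ⟨h, h'⟩
    · have h2 := hT.add_lt _ _ h' fun h0 => hne (Prod.ext h h0)
      simp only at h h2
      subst h
      -- This could fail only for `s = t = true`, but two heavier ends of inner pairs weigh at least
      -- `E` together, contradicting `h2`.
      have h3 : p (i, s) + p (i, t) ≤ D := by
        have h4 := hG.add_eq i
        have h5 := hG.le i
        have h6 := hT.le a
        have h7 := hT.le b
        have h8 := hT.add_eq a
        have h9 := hT.add_eq b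
        cases s <;> cases t <;> omega
      have := Nat.mul_le_mul_left (E + 1) h3
      rw [Nat.mul_add] at this
      omega
    · have h1 : p (i, s) + p (j, t) + 1 ≤ D := hG.add_lt _ _ h' h
      have h2 := hT.weight_le (a, s)
      have h3 := hT.weight_le (b, t)
      have := Nat.mul_le_mul_left (E + 1) h1
      rw [Nat.mul_add, Nat.mul_add] at this
      omega

/-! ### Copies of the graph in its iterated substitution -/

/-- The pairs indexed by `c` span a copy of `G` in `T`. -/
def IsCopy {I Λ : Type*} (G : SimpleGraph (I × Bool)) (T : SimpleGraph (Λ × Bool))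
    (c : I → Λ) : Prop :=
  Function.Injective c ∧ ∀ i j s t, T.Adj (c i, s) (c j, t) ↔ G.Adj (i, s) (j, t)

theorem IsCopy.inner {I Λ : Type*} {G : SimpleGraph (I × Bool)} {T : SimpleGraph (Λ × Bool)}
    {c : I → Λ} (hc : IsCopy G T c) (i₀ : I) :
    IsCopy G (substGraph G T) fun i => (i₀, c i) := by
  refine ⟨fun i j h => hc.1 (Prod.ext_iff.1 h).2, fun i j s t => ?_⟩
  simp [substGraph, hc.2]

theorem IsWeightedPairing.isCopy_section {I Λ : Type*} {G : SimpleGraph (I × Bool)}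
    {T : SimpleGraph (Λ × Bool)} {p : I × Bool → ℕ} {q : Λ × Bool → ℕ} {D E : ℕ}
    (hG : IsWeightedPairing G p D) (hT : IsWeightedPairing T q E) (φ : I → Λ) :
    IsCopy G (substGraph G T) fun i => (i, φ i) := by
  refine ⟨fun i j h => (Prod.ext_iff.1 h).1, fun i j s t => ?_⟩
  rcases eq_or_ne i j with rfl | h
  · simp [substGraph, hG.adj_iff, hT.adj_iff]
  · simp [substGraph, h]

/-- The number of copies of a graph with `k` matching edges in its `d`-fold iterated
substitution. -/
def copyCount (k : ℕ) : ℕ → ℕ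
  | 0 => 0
  | d + 1 => k * copyCount k d + (k ^ d) ^ k

/-- A copy at depth `d + 1` either lies inside one block or picks one pair from every block; with at
least two blocks these kinds are disjoint. -/
theorem IsWeightedPairing.exists_iterated {I : Type u} [Fintype I] [Nontrivial I]
    {G : SimpleGraph (I × Bool)} {p : I × Bool → ℕ} {D : ℕ} (hG : IsWeightedPairing G p D)
    (d : ℕ) :
    ∃ (Λ : Type u) (_ : Fintype Λ) (T : SimpleGraph (Λ × Bool)) (q : Λ × Bool → ℕ) (E : ℕ)
      (C : Finset (I → Λ)), IsWeightedPairing T q E ∧ (∀ c ∈ C, IsCopy G T c) ∧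
        (∀ c ∈ C, ∀ c' ∈ C, Set.range c = Set.range c' → c = c') ∧
        Fintype.card Λ = Fintype.card I ^ d ∧ C.card = copyCount (Fintype.card I) d := by
  classical
  induction d with
  | zero =>
    -- Depth zero is a single edge with both ends of weight `1`.
    refine ⟨PUnit, inferInstance, ⊤, fun _ => 1, 2, ∅, ⟨by simp, by simp, by simp, by simp, ?_⟩,
      by simp, by simp, by simp, by simp [copyCount]⟩
    intro u v _ h
    exact absurd rfl h
  | succ d ih =>
    obtain ⟨Λ, _, T, q, E, C, hT, hC, hinj, hΛ, hcard⟩ := ih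
    let f : I × (I → Λ) → I → I × Λ := fun x i => (x.1, x.2 i)
    let g : (I → Λ) → I → I × Λ := fun φ i => (i, φ i)
    have hf : Function.Injective f := by
      rintro ⟨i, c⟩ ⟨j, c'⟩ h
      have h0 := fun l => Prod.ext_iff.1 (congrFun h l)
      exact Prod.ext (h0 i).1 (funext fun l => (h0 l).2)
    have hg : Function.Injective g := fun φ ψ h =>
      funext fun l => (Prod.ext_iff.1 (congrFun h l)).2
    have hfg : ∀ x φ, Set.range (f x) ≠ Set.range (g φ) := by
      intro x φ h
      obtain ⟨i, hi⟩ := exists_ne x.1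
      obtain ⟨j, hj⟩ : g φ i ∈ Set.range (f x) := h ▸ ⟨i, rfl⟩
      exact hi (Prod.ext_iff.1 hj).1.symm
    refine ⟨I × Λ, inferInstance, substGraph G T, _, _,
      ((Finset.univ ×ˢ C).image f) ∪ (Finset.univ.image g), hG.subst hT, ?_, ?_, ?_, ?_⟩
    · intro c hc
      simp only [Finset.mem_union, Finset.mem_image, Finset.mem_product, Finset.mem_univ,
        true_and] at hc
      rcases hc with ⟨x, hx, rfl⟩ | ⟨φ, rfl⟩
      · exact (hC _ hx).inner _
      · exact hG.isCopy_section hT φ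
    · intro c hc c' hc' h
      simp only [Finset.mem_union, Finset.mem_image, Finset.mem_product, Finset.mem_univ,
        true_and] at hc hc'
      rcases hc with ⟨x, hx, rfl⟩ | ⟨φ, rfl⟩ <;> rcases hc' with ⟨y, hy, rfl⟩ | ⟨ψ, rfl⟩
      · have h1 : ∀ x y : I × (I → Λ), Set.range (f x) ⊆ Set.range (f y) →
            x.1 = y.1 ∧ Set.range x.2 ⊆ Set.range y.2 := by
          intro x y h
          refine ⟨?_, ?_⟩
          · obtain ⟨j, hj⟩ := h ⟨x.1, rfl⟩
            exact (Prod.ext_iff.1 hj).1.symm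
          · rintro _ ⟨i, rfl⟩
            obtain ⟨j, hj⟩ := h ⟨i, rfl⟩
            exact ⟨j, (Prod.ext_iff.1 hj).2⟩
        have h2 := h1 x y h.subset
        have h3 := h1 y x h.superset
        rw [show x = y from Prod.ext h2.1 (hinj _ hx _ hy (h2.2.antisymm h3.2))]
      · exact absurd h (hfg _ _)
      · exact absurd h.symm (hfg _ _)
      · congr 1
        ext1 i
        obtain ⟨j, hj⟩ : g φ i ∈ Set.range (g ψ) := h ▸ ⟨i, rfl⟩
        have h4 := Prod.ext_iff.1 hj
        obtain rfl : j = i := h4.1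
        exact h4.2.symm
    · rw [Fintype.card_prod, hΛ, pow_succ']
    · rw [Finset.card_union_of_disjoint, Finset.card_image_of_injective _ hf,
        Finset.card_image_of_injective _ hg, Finset.card_product, hcard]
      · simp [copyCount, hΛ]
      · rw [Finset.disjoint_left]
        simp only [Finset.mem_image, Finset.mem_univ, true_and, not_exists]
        rintro _ ⟨x, -, rfl⟩ φ h
        exact hfg x φ (by rw [h])

/-- The ratio satisfies `r ↦ (k / k ^ k) * r + 1 / k ^ k`, a contraction with fixed point `1 / (k ^
k - k)`. -/
theorem tendsto_copyCount {k : ℕ} (hk : 2 ≤ k) :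
    Filter.Tendsto (fun d => (copyCount k d : ℝ) / ((k : ℝ) ^ d) ^ k) Filter.atTop
      (nhds (1 / ((k : ℝ) ^ k - k))) := by
  have hk1 : (1 : ℝ) < k := by exact_mod_cast hk
  have hk0 : (0 : ℝ) < k := by linarith
  have hkk : (k : ℝ) < (k : ℝ) ^ k := by
    simpa using pow_lt_pow_right₀ hk1 (show 1 < k from hk)
  have hne : (k : ℝ) ^ k - k ≠ 0 := by linarith
  have hkp : (k : ℝ) ^ k ≠ 0 := by positivity
  have key : ∀ d, (copyCount k d : ℝ) / ((k : ℝ) ^ d) ^ k =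
      1 / ((k : ℝ) ^ k - k) - 1 / ((k : ℝ) ^ k - k) * ((k : ℝ) / (k : ℝ) ^ k) ^ d := by
    intro d
    induction d with
    | zero => simp [copyCount]
    | succ d ih =>
      have hd : ((k : ℝ) ^ d) ^ k ≠ 0 := by positivity
      have : (copyCount k (d + 1) : ℝ) / ((k : ℝ) ^ (d + 1)) ^ k =
          (k / (k : ℝ) ^ k) * ((copyCount k d : ℝ) / ((k : ℝ) ^ d) ^ k) + 1 / (k : ℝ) ^ k := by
        rw [pow_succ, mul_pow]
        simp only [copyCount]
        push_cast
        field_simp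
      rw [this, ih, pow_succ]
      generalize ((k : ℝ) / (k : ℝ) ^ k) ^ d = z
      field_simp
      ring
  simp_rw [key]
  have h0 : Filter.Tendsto (fun d => ((k : ℝ) / (k : ℝ) ^ k) ^ d) Filter.atTop (nhds 0) :=
    tendsto_pow_atTop_nhds_zero_of_lt_one (by positivity) ((div_lt_one (by positivity)).2 hkk)
  simpa using (h0.const_mul (1 / ((k : ℝ) ^ k - k))).const_sub (1 / ((k : ℝ) ^ k - k))

/-! ### Edges and induced copies in weighted blow-ups -/

/-- The blow-up of `T` in which the vertex `w` is replaced by `s w` independent vertices. -/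
abbrev blowUp {W : Type*} (T : SimpleGraph W) (s : W → ℕ) : SimpleGraph (Σ w, Fin (s w)) :=
  T.comap Sigma.fst

theorem two_mul_ncard_edgeSet_blowUp {W : Type*} [Fintype W] (T : SimpleGraph W)
    [DecidableRel T.Adj] (s : W → ℕ) :
    2 * (blowUp T s).edgeSet.ncard = ∑ u, ∑ v, if T.Adj u v then s u * s v else 0 := by
  classical
  rw [← SimpleGraph.coe_edgeFinset, Set.ncard_coe_finset,
    ← SimpleGraph.sum_degrees_eq_twice_card_edges, Fintype.sum_sigma]
  refine Finset.sum_congr rfl fun u _ => ?_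
  have : ∀ x : Fin (s u), (blowUp T s).degree ⟨u, x⟩ = ∑ v, if T.Adj u v then s v else 0 := by
    intro x
    rw [← SimpleGraph.card_neighborFinset_eq_degree, SimpleGraph.neighborFinset_eq_filter,
      Finset.card_filter, Fintype.sum_sigma]
    refine Finset.sum_congr rfl fun v _ => ?_
    by_cases h : T.Adj u v <;> simp [h]
  simp only [this, Finset.sum_const, Finset.card_univ, Fintype.card_fin, smul_eq_mul,
    Finset.mul_sum, mul_ite, mul_zero]

theorem IsWeightedPairing.le_two_mul_ncard_edgeSet_blowUp {Λ : Type*} [Fintype Λ]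
    {T : SimpleGraph (Λ × Bool)} {q : Λ × Bool → ℕ} {E : ℕ} (hT : IsWeightedPairing T q E)
    [Nonempty Λ] (n : ℕ) :
    n ≤ 2 * (blowUp T fun w => n ^ q w).edgeSet.ncard := by
  classical
  rw [two_mul_ncard_edgeSet_blowUp]
  obtain ⟨l⟩ := ‹Nonempty Λ›
  calc n ≤ n ^ E := Nat.le_self_pow hT.pos.ne' n
    _ = if T.Adj (l, false) (l, true) then n ^ q (l, false) * n ^ q (l, true) else 0 := by
        rw [if_pos (hT.adj l), ← pow_add, hT.add_eq]
    _ ≤ ∑ v, if T.Adj (l, false) v then n ^ q (l, false) * n ^ q v else 0 :=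
        Finset.single_le_sum
          (f := fun v => if T.Adj (l, false) v then n ^ q (l, false) * n ^ q v else 0)
          (fun _ _ => Nat.zero_le _) (Finset.mem_univ _)
    _ ≤ _ :=
        Finset.single_le_sum
          (f := fun u => ∑ v, if T.Adj u v then n ^ q u * n ^ q v else 0)
          (fun _ _ => Nat.zero_le _) (Finset.mem_univ _)

theorem IsWeightedPairing.two_mul_ncard_edgeSet_blowUp_le {Λ : Type*} [Fintype Λ]
    {T : SimpleGraph (Λ × Bool)} {q : Λ × Bool → ℕ} {E : ℕ} (hT : IsWeightedPairing T q E)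
    {n : ℕ} (hn : 0 < n) :
    2 * (blowUp T fun w => n ^ q w).edgeSet.ncard ≤
      2 * Fintype.card Λ * n ^ E + (2 * Fintype.card Λ) ^ 2 * n ^ (E - 1) := by
  classical
  rw [two_mul_ncard_edgeSet_blowUp]
  have hW : Fintype.card (Λ × Bool) = 2 * Fintype.card Λ := by
    rw [Fintype.card_prod, Fintype.card_bool, mul_comm]
  have key : ∀ u v : Λ × Bool, (if T.Adj u v then n ^ q u * n ^ q v else 0) ≤
      -- Only the partner of `u` contributes the leading power; any other neighbour loses at least
      -- one factor `n`.
      (if v = (u.1, !u.2) then n ^ E else 0) + n ^ (E - 1) := by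
    intro u v
    by_cases h : T.Adj u v
    · rw [if_pos h, ← pow_add]
      by_cases h1 : u.1 = v.1
      · obtain ⟨a, s⟩ := u
        obtain ⟨b, t⟩ := v
        simp only at h1
        subst h1
        have hst := (hT.adj_iff _ _ _).1 h
        have h2 := hT.add_eq a
        have : q (a, s) + q (a, t) = E := by
          cases s <;> cases t <;> first | exact absurd rfl hst | omega
        rw [this, if_pos (by cases s <;> cases t <;> simp_all)]
        exact Nat.le_add_right _ _
      · have := hT.add_lt u v h h1
        exact (Nat.pow_le_pow_right hn (by omega)).trans (Nat.le_add_left _ _)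
    · simp [h]
  refine (Finset.sum_le_sum fun u _ => Finset.sum_le_sum fun v _ => key u v).trans ?_
  simp only [Finset.sum_add_distrib, Finset.sum_ite_eq', Finset.mem_univ, if_true,
    Finset.sum_const, Finset.card_univ, hW, smul_eq_mul]
  exact le_of_eq (by ring)

theorem inducedCount_le_of_iso {V W W' : Type*} [Finite W'] (G : SimpleGraph V)
    {H : SimpleGraph W} {H' : SimpleGraph W'} (e : H ≃g H') :
    inducedCount G H ≤ inducedCount G H' := by
  refine Set.ncard_le_ncard_of_injOn (fun S => e '' S) ?_
    (Set.image_injective.2 e.injective).injOn (Set.toFinite _)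
  rintro S ⟨f⟩
  refine ⟨RelIso.trans (RelIso.symm ⟨e.toEquiv.image S, ?_⟩) f⟩
  intro a b
  exact e.map_rel_iff

/-- Choose a copy in `C` and one vertex in each of its classes. The class sizes of a pair multiply
to `n ^ E`, and the resulting vertex set determines both the copy and the choices. -/
theorem card_mul_pow_le_inducedCount_blowUp {I Λ : Type*} [Fintype I] [Fintype Λ]
    {G : SimpleGraph (I × Bool)} {T : SimpleGraph (Λ × Bool)} {q : Λ × Bool → ℕ} {E : ℕ}
    (hT : IsWeightedPairing T q E) {C : Finset (I → Λ)} (hC : ∀ c ∈ C, IsCopy G T c)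
    (hinj : ∀ c ∈ C, ∀ c' ∈ C, Set.range c = Set.range c' → c = c') (n : ℕ) :
    C.card * (n ^ E) ^ Fintype.card I ≤ inducedCount G (blowUp T fun w => n ^ q w) := by
  classical
  let f : (Σ c : C, ∀ v : I × Bool, Fin (n ^ q (c.1 v.1, v.2))) → I × Bool →
      Σ w : Λ × Bool, Fin (n ^ q w) := fun x v => ⟨(x.1.1 v.1, v.2), x.2 v⟩
  have hf : ∀ x, Function.Injective (f x) := by
    intro x v w h
    have h1 := congrArg Sigma.fst h
    exact Prod.ext ((hC _ x.1.2).1 (Prod.ext_iff.1 h1).1) (Prod.ext_iff.1 h1).2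
  have hfinj : Function.Injective fun x => Set.range (f x) := by
    rintro ⟨⟨c, hc⟩, x⟩ ⟨⟨c', hc'⟩, y⟩ h
    have hrange : ∀ x, Set.range x.1.1 = (fun w => w.1.1) '' Set.range (f x) := by
      intro x
      ext l
      constructor
      · rintro ⟨i, rfl⟩
        exact ⟨_, ⟨(i, true), rfl⟩, rfl⟩
      · rintro ⟨_, ⟨i, rfl⟩, rfl⟩
        exact ⟨i.1, rfl⟩
    obtain rfl : c = c' := hinj c hc c' hc' <| by
      have h1 := hrange ⟨⟨c, hc⟩, x⟩
      have h2 := hrange ⟨⟨c', hc'⟩, y⟩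
      simp only at h h1 h2
      rw [h1, h2, h]
    congr 1
    ext1 v
    obtain ⟨w, hw⟩ : f ⟨⟨c, hc⟩, x⟩ v ∈ Set.range (f ⟨⟨c, hc⟩, y⟩) :=
      h.subset ⟨v, rfl⟩
    have h1 := congrArg Sigma.fst hw
    obtain rfl : w = v := Prod.ext ((hC _ hc).1 (Prod.ext_iff.1 h1).1) (Prod.ext_iff.1 h1).2
    exact (eq_of_heq (Sigma.mk.inj_iff.1 hw).2).symm
  have hcopy : ∀ x, Set.range (f x) ∈
      {S | Nonempty ((blowUp T fun w => n ^ q w).induce S ≃g G)} := by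
    intro x
    refine ⟨RelIso.symm ⟨Equiv.ofInjective _ (hf x), ?_⟩⟩
    intro v w
    exact (hC _ x.1.2).2 _ _ _ _
  have hcard : Fintype.card (Σ c : C, ∀ v : I × Bool, Fin (n ^ q (c.1 v.1, v.2))) =
      C.card * (n ^ E) ^ Fintype.card I := by
    rw [Fintype.card_sigma]
    have : ∀ c : C, Fintype.card (∀ v : I × Bool, Fin (n ^ q (c.1 v.1, v.2))) =
        (n ^ E) ^ Fintype.card I := by
      intro c
      rw [Fintype.card_pi, Fintype.prod_prod_type]
      simp only [Fintype.card_fin, Fintype.prod_bool, ← pow_add, add_comm (q (_, true)),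
        hT.add_eq, Finset.prod_const, Finset.card_univ]
    simp [this]
  rw [← hcard, ← Nat.card_eq_fintype_card, ← Set.ncard_univ,
    ← Set.ncard_image_of_injective _ hfinj]
  refine Set.ncard_le_ncard ?_ (Set.toFinite _)
  rintro _ ⟨x, -, rfl⟩
  exact hcopy x

/-! ### Normalisation for graphs with a perfect matching -/

section Pairing

variable {V I : Type*} [Fintype I] {G : SimpleGraph V} (e : V ≃ I × Bool)


/-- The constant weight `1 / 2` attains the upper bound obtained by summing over the matching edges.
-/
theorem fracIndepNum_eq_card [Fintype V]
    (he : ∀ i, G.Adj (e.symm (i, false)) (e.symm (i, true))) :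
    fracIndepNum G = Fintype.card I := by
  have hsum : ∀ α : V → ℝ, ∑ v, α v = ∑ i, (α (e.symm (i, true)) + α (e.symm (i, false))) := by
    intro α
    rw [← e.symm.sum_comp, Fintype.sum_prod_type]
    simp
  refine IsGreatest.csSup_eq ⟨⟨fun _ => 1 / 2, ⟨fun v => by norm_num, fun u v _ => by norm_num⟩,
    ?_⟩, ?_⟩
  · rw [hsum]
    norm_num
  · rintro _ ⟨α, hα, rfl⟩
    rw [hsum]
    calc _ ≤ ∑ _i : I, (1 : ℝ) := Finset.sum_le_sum fun i _ => hα.2 _ _ (he i).symm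
      _ = _ := by simp

/-- An induced copy is the union of the edges of `H` onto which the matching is mapped, so these
edges determine it. -/
theorem inducedCount_le_pow (he : ∀ i, G.Adj (e.symm (i, false)) (e.symm (i, true)))
    {W : Type*} [Finite W] (H : SimpleGraph W) :
    inducedCount G H ≤ H.edgeSet.ncard ^ Fintype.card I := by
  classical
  let f : {S : Set W | Nonempty (H.induce S ≃g G)} → I → H.edgeSet := fun S i =>
    ⟨s(((S.2.some.symm (e.symm (i, false)) : S.1) : W), S.2.some.symm (e.symm (i, true))),
      S.2.some.symm.map_rel_iff.2 (he i)⟩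
  have hf : ∀ S, S.1 = {x | ∃ i, x ∈ (f S i).1} := by
    intro S
    ext x
    constructor
    · intro hx
      obtain ⟨⟨i, s⟩, hv⟩ := e.symm.surjective (S.2.some ⟨x, hx⟩)
      have hx' : ((S.2.some.symm (e.symm (i, s)) : S.1) : W) = x := by rw [hv]; simp
      refine ⟨i, Sym2.mem_iff.2 ?_⟩
      cases s
      · exact Or.inl hx'.symm
      · exact Or.inr hx'.symm
    · rintro ⟨i, hi⟩
      rcases Sym2.mem_iff.1 hi with rfl | rfl <;> exact Subtype.coe_prop _
  have hinj : Function.Injective f := by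
    intro S S' h
    apply Subtype.ext
    rw [hf S, hf S', h]
  have := Nat.card_le_card_of_injective f hinj
  rwa [Nat.card_fun, Nat.card_coe_set_eq, Nat.card_coe_set_eq, Nat.card_eq_fintype_card] at this

theorem pow_mem_upperBounds_inducedCount (he : ∀ i, G.Adj (e.symm (i, false)) (e.symm (i, true))) (m : ℕ) :
    (m ^ Fintype.card I) ∈ upperBounds {N : ℕ | ∃ (n : ℕ) (H : SimpleGraph (Fin n)),
      H.edgeSet.ncard = m ∧ N = inducedCount G H} := by
  rintro _ ⟨n, H, rfl, rfl⟩
  exact inducedCount_le_pow e he H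

theorem inducedCount_le_eindEdges (he : ∀ i, G.Adj (e.symm (i, false)) (e.symm (i, true)))
    {W : Type*} [Finite W] (H : SimpleGraph W) :
    inducedCount G H ≤ eindEdges G H.edgeSet.ncard := by
  let g := Finite.equivFin W
  let φ : H ≃g H.map g.toEmbedding := SimpleGraph.Iso.map g H
  refine (inducedCount_le_of_iso G φ).trans
    (le_csSup ⟨_, pow_mem_upperBounds_inducedCount e he _⟩ ⟨_, _, ?_, rfl⟩)
  rw [← Nat.card_coe_set_eq, ← Nat.card_coe_set_eq]
  exact Nat.card_congr φ.symm.mapEdgeSet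

theorem eindEdges_le_pow (he : ∀ i, G.Adj (e.symm (i, false)) (e.symm (i, true))) (m : ℕ) :
    eindEdges G m ≤ m ^ Fintype.card I := by
  rcases Set.eq_empty_or_nonempty {N : ℕ | ∃ (n : ℕ) (H : SimpleGraph (Fin n)),
      H.edgeSet.ncard = m ∧ N = inducedCount G H} with h | h
  · simp [eindEdges, h]
  · exact csSup_le h (pow_mem_upperBounds_inducedCount e he m)

/-- Infinitely many edge counts suffice for a lower bound on the limsup, because `eindEdges_le_pow`
keeps the real sequence bounded. -/
theorem le_eind_of_frequently [Fintype V]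
    (he : ∀ i, G.Adj (e.symm (i, false)) (e.symm (i, true))) {b : ℝ}
    (hb : ∃ᶠ m : ℕ in Filter.atTop, b ≤ (Nat.card (G ≃g G) : ℝ) * (eindEdges G m : ℝ) /
      (2 * (m : ℝ)) ^ Fintype.card I) : b ≤ eind G := by
  unfold eind
  simp only [fracIndepNum_eq_card e he, Real.rpow_natCast]
  refine Filter.le_limsup_of_frequently_le hb ?_
  refine Filter.isBoundedUnder_of_eventually_le (a := (Nat.card (G ≃g G) : ℝ)) ?_
  filter_upwards [Filter.eventually_ge_atTop 1] with m hm
  have hm' : (1 : ℝ) ≤ m := by exact_mod_cast hm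
  rw [div_le_iff₀ (by positivity)]
  refine mul_le_mul_of_nonneg_left ?_ (Nat.cast_nonneg _)
  calc (eindEdges G m : ℝ) ≤ (m : ℝ) ^ Fintype.card I := by exact_mod_cast eindEdges_le_pow e he m
    _ ≤ _ := pow_le_pow_left₀ (by positivity) (by linarith) _

end Pairing

/-! ### The lower bound from a weighted pairing -/

theorem IsWeightedPairing.le_eind_of_family {V I Λ : Type*} [Fintype V] [Fintype I] [Fintype Λ]
    [Nonempty Λ] {G₀ : SimpleGraph V}
    {G : SimpleGraph (I × Bool)} (e : G₀ ≃g G) {p : I × Bool → ℕ} {D : ℕ}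
    (hG : IsWeightedPairing G p D) {T : SimpleGraph (Λ × Bool)} {q : Λ × Bool → ℕ} {E : ℕ}
    (hT : IsWeightedPairing T q E) {C : Finset (I → Λ)} (hC : ∀ c ∈ C, IsCopy G T c)
    (hinj : ∀ c ∈ C, ∀ c' ∈ C, Set.range c = Set.range c' → c = c') :
    Nat.card (G₀ ≃g G₀) / 2 ^ Fintype.card I *
      ((C.card : ℝ) / (Fintype.card Λ : ℝ) ^ Fintype.card I) ≤ eind G₀ := by
  have he : ∀ i, G₀.Adj (e.toEquiv.symm (i, false)) (e.toEquiv.symm (i, true)) := fun i =>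
    e.symm.map_rel_iff.2 (hG.adj i)
  set k := Fintype.card I
  set L := Fintype.card Λ
  set A := Nat.card (G₀ ≃g G₀)
  have hL : (0 : ℝ) < L := by exact_mod_cast (Fintype.card_pos : 0 < Fintype.card Λ)
  let m : ℕ → ℕ := fun n => (blowUp T fun w => n ^ q w).edgeSet.ncard
  have hm : Filter.Tendsto m Filter.atTop Filter.atTop := by
    refine Filter.tendsto_atTop_mono (f := fun n => n / 2) (fun n => ?_)
      (Filter.tendsto_atTop.2 fun b => ?_)
    · have := hT.le_two_mul_ncard_edgeSet_blowUp n
      simp only [m]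
      omega
    · filter_upwards [Filter.eventually_ge_atTop (2 * b)] with n hn
      omega
  have hlim : Filter.Tendsto (fun n : ℕ => (A : ℝ) * C.card /
      (2 * (L : ℝ) + (2 * (L : ℝ)) ^ 2 / n) ^ k) Filter.atTop
      (nhds ((A : ℝ) * C.card / (2 * (L : ℝ) + 0) ^ k)) := by
    refine Filter.Tendsto.div tendsto_const_nhds (Filter.Tendsto.pow
      (tendsto_const_nhds.add (tendsto_const_div_atTop_nhds_zero_nat _)) _) (by positivity)
  have hb : (A : ℝ) / 2 ^ k * ((C.card : ℝ) / (L : ℝ) ^ k) =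
      (A : ℝ) * C.card / (2 * (L : ℝ) + 0) ^ k := by
    rw [add_zero, mul_pow]
    field_simp
  rw [hb]
  refine le_of_forall_lt fun b hb => ?_
  obtain ⟨b', hbb', hb'⟩ := exists_between hb
  refine hbb'.trans_le (le_eind_of_frequently e.toEquiv he (hm.frequently
    (Filter.Eventually.frequently ?_)))
  filter_upwards [hlim.eventually_const_lt hb', Filter.eventually_ge_atTop 1] with n hn hn1
  refine hn.le.trans ?_
  have hn0 : (1 : ℝ) ≤ n := by exact_mod_cast hn1
  have hcount : C.card * (n ^ E) ^ k ≤ eindEdges G₀ (m n) := by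
    refine (card_mul_pow_le_inducedCount_blowUp hT hC hinj n).trans ?_
    have : inducedCount G (blowUp T fun w => n ^ q w) =
        inducedCount G₀ (blowUp T fun w => n ^ q w) := by
      unfold inducedCount
      congr 1
      ext S
      exact ⟨fun ⟨f⟩ => ⟨f.trans e.symm⟩, fun ⟨f⟩ => ⟨f.trans e⟩⟩
    rw [this]
    exact inducedCount_le_eindEdges e.toEquiv he _
  have hedge : 2 * (m n : ℝ) ≤ (n : ℝ) ^ E * (2 * (L : ℝ) + (2 * (L : ℝ)) ^ 2 / n) := by
    have h1 : 2 * (m n : ℝ) ≤ 2 * (L : ℝ) * (n : ℝ) ^ E + (2 * (L : ℝ)) ^ 2 * (n : ℝ) ^ (E - 1) := by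
      exact_mod_cast hT.two_mul_ncard_edgeSet_blowUp_le hn1
    refine h1.trans_eq ?_
    obtain ⟨E', hE'⟩ := Nat.exists_eq_succ_of_ne_zero hT.pos.ne'
    rw [hE', Nat.succ_sub_one, Nat.succ_eq_add_one, pow_succ]
    field_simp
  have hmpos : 0 < (m n : ℝ) := by
    have := hT.le_two_mul_ncard_edgeSet_blowUp n
    exact_mod_cast (by simp only [m]; omega : 0 < m n)
  calc (A : ℝ) * C.card / (2 * (L : ℝ) + (2 * (L : ℝ)) ^ 2 / n) ^ k
      = (A : ℝ) * (C.card * ((n : ℝ) ^ E) ^ k) /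
          ((n : ℝ) ^ E * (2 * (L : ℝ) + (2 * (L : ℝ)) ^ 2 / n)) ^ k := by
        rw [mul_pow _ _ k, ← mul_assoc, mul_comm _ (((n : ℝ) ^ E) ^ k),
          mul_div_mul_left _ _ (by positivity)]
    _ ≤ (A : ℝ) * (C.card * ((n : ℝ) ^ E) ^ k) / (2 * (m n : ℝ)) ^ k := by gcongr
    _ ≤ (A : ℝ) * eindEdges G₀ (m n) / (2 * (m n : ℝ)) ^ k := by
        gcongr
        exact_mod_cast hcount

theorem IsWeightedPairing.le_eind {V : Type*} {I : Type u} [Fintype V] [Fintype I]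
    {G₀ : SimpleGraph V} {G : SimpleGraph (I × Bool)} (e : G₀ ≃g G) {p : I × Bool → ℕ} {D : ℕ}
    (hG : IsWeightedPairing G p D) (hI : 2 ≤ Fintype.card I) :
    (Nat.card (G₀ ≃g G₀) : ℝ) /
      (2 ^ Fintype.card I * ((Fintype.card I : ℝ) ^ Fintype.card I - Fintype.card I)) ≤
      eind G₀ := by
  have : Nontrivial I := Fintype.one_lt_card_iff_nontrivial.1 hI
  have key : ∀ d, (Nat.card (G₀ ≃g G₀) : ℝ) / 2 ^ Fintype.card I *
      ((copyCount (Fintype.card I) d : ℝ) / ((Fintype.card I : ℝ) ^ d) ^ Fintype.card I) ≤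
      eind G₀ := by
    intro d
    obtain ⟨Λ, _, T, q, E, C, hT, hC, hinj, hΛ, hcard⟩ := hG.exists_iterated d
    have : Nonempty Λ := Fintype.card_pos_iff.1 (by rw [hΛ]; positivity)
    have h := hG.le_eind_of_family e hT hC hinj
    rw [hΛ, hcard] at h
    exact_mod_cast h
  rw [show (Nat.card (G₀ ≃g G₀) : ℝ) /
      (2 ^ Fintype.card I * ((Fintype.card I : ℝ) ^ Fintype.card I - Fintype.card I)) =
      Nat.card (G₀ ≃g G₀) / 2 ^ Fintype.card I *
        (1 / ((Fintype.card I : ℝ) ^ Fintype.card I - Fintype.card I)) by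
    rw [div_mul_div_comm, mul_one]]
  exact le_of_tendsto' ((tendsto_copyCount hI).const_mul _) key

/-! ### Alternating walks and weights from uniqueness -/

/-- `AltStep G M x v` says that `v, u, x` is a walk for some `u`, whose first edge is an edge of
`G` outside `M` and whose second edge is in `M`. -/
def AltStep {V : Type*} (G : SimpleGraph V) (M : G.Subgraph) (x v : V) : Prop :=
  ∃ u, G.Adj v u ∧ ¬ M.Adj v u ∧ M.Adj u x

open Classical in
theorem sum_ite_sym2_eq {V : Type*} [Fintype V] {a b : V} (hab : a ≠ b) (z : V) :
    ∑ u, (if s(z, u) = s(a, b) then (1 : ℝ) else 0) =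
      (if z = a then 1 else 0) + (if z = b then 1 else 0) := by
  have : ∀ u, (if s(z, u) = s(a, b) then (1 : ℝ) else 0) =
      (if u = b then (if z = a then 1 else 0) else 0) +
        (if u = a then (if z = b then 1 else 0) else 0) := by
    intro u
    simp only [Sym2.eq_iff]
    split_ifs <;> simp_all
  simp only [this, Finset.sum_add_distrib, Finset.sum_ite_eq', Finset.mem_univ, if_true]

open Classical in
/-- The signed edge weights of an alternating walk from `v` to `x`. -/
theorem exists_flow_of_transGen {V : Type*} [Fintype V] {G : SimpleGraph V} {M : G.Subgraph}
    {x v : V} (h : Relation.TransGen (AltStep G M) x v) :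
    ∃ p : Sym2 V → ℝ, (∀ e ∉ G.edgeSet, p e = 0) ∧ (∀ e ∉ M.edgeSet, 0 ≤ p e) ∧
      (∃ e ∈ G.edgeSet, e ∉ M.edgeSet ∧ 0 < p e) ∧
      ∀ z, ∑ u, p s(z, u) = (if z = v then 1 else 0) - (if z = x then 1 else 0) := by
  have step : ∀ {x v}, AltStep G M x v → ∃ p : Sym2 V → ℝ, (∀ e ∉ G.edgeSet, p e = 0) ∧
      (∀ e ∉ M.edgeSet, 0 ≤ p e) ∧ (∃ e ∈ G.edgeSet, e ∉ M.edgeSet ∧ 0 < p e) ∧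
      ∀ z, ∑ u, p s(z, u) = (if z = v then 1 else 0) - (if z = x then 1 else 0) := by
    rintro x v ⟨u, hvu, hM, hux⟩
    have hne : s(v, u) ≠ s(u, x) := fun h => hM (M.mem_edgeSet.1 (h ▸ M.mem_edgeSet.2 hux))
    -- Put `+1` on the edge outside `M` and `-1` on the matching edge: the contributions at the
    -- middle vertex cancel, so concatenated steps telescope.
    refine ⟨fun e => (if e = s(v, u) then 1 else 0) - (if e = s(u, x) then 1 else 0),
      fun e he => ?_, fun e he => ?_, ⟨s(v, u), hvu, hM, ?_⟩, fun z => ?_⟩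
    · simp only
      rw [if_neg, if_neg, sub_zero]
      · rintro rfl
        exact he (M.adj_sub hux)
      · rintro rfl
        exact he hvu
    · have : e ≠ s(u, x) := by
        rintro rfl
        exact he hux
      simp only [if_neg this, sub_zero]
      split_ifs <;> norm_num
    · simp [hne]
    · rw [Finset.sum_sub_distrib, sum_ite_sym2_eq hvu.ne, sum_ite_sym2_eq (M.adj_sub hux).ne]
      ring
  induction h with
  | single h => exact step h
  | tail _ h ih =>
    obtain ⟨p, h1, h2, ⟨e, he, heM, hpos⟩, h3⟩ := ih
    obtain ⟨q, h1', h2', -, h3'⟩ := step h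
    refine ⟨fun e => p e + q e, fun e he => by simp only [h1 e he, h1' e he, add_zero],
      fun e he => add_nonneg (h2 e he) (h2' e he),
      ⟨e, he, heM, add_pos_of_pos_of_nonneg hpos (h2' e heM)⟩, fun z => ?_⟩
    rw [Finset.sum_add_distrib, h3, h3']
    ring

theorem IsUniqueFractionalPerfectMatching.not_transGen {V : Type*} [Fintype V]
    {G : SimpleGraph V} {M : G.Subgraph} (hM : IsUniqueFractionalPerfectMatching G M) (v : V) :
    ¬ Relation.TransGen (AltStep G M) v v := by
  classical
  intro h
  obtain ⟨p, hp0, hpM, ⟨e₀, he₀, he₀M, hpos⟩, hsum⟩ := exists_flow_of_transGen h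
  have hsum0 : ∀ z, ∑ u, p s(z, u) = 0 := fun z => by rw [hsum, sub_self]
  set S := ∑ e, |p e|
  have hS : ∀ e, |p e| ≤ S := fun e =>
    Finset.single_le_sum (f := fun e => |p e|) (fun _ _ => abs_nonneg _) (Finset.mem_univ e)
  have hS0 : 0 ≤ S := Finset.sum_nonneg fun _ _ => abs_nonneg _
  -- The scaling keeps the decrease on edges of `M` at most `1`; off `M` the perturbation is
  -- nonnegative.
  let w : G.edgeSet → ℝ := fun e => edgeIndicator M e + (1 + S)⁻¹ * p e
  have hw0 : ∀ e, 0 ≤ w e := by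
    intro e
    simp only [w, edgeIndicator]
    split_ifs with he
    · have h1 := neg_le_of_abs_le (hS e)
      have h2 : (1 + S)⁻¹ * (-p e) ≤ 1 := by
        rw [inv_mul_le_iff₀ (by linarith)]
        linarith
      linarith
    · have := hpM e he
      positivity
  have hwsum : ∀ v : V, ∑ u : G.neighborSet v, w ⟨s(v, (u : V)), G.mem_edgeSet.2 u.2⟩ = 1 := by
    intro v
    have h1 := ((hM.2 _).2 rfl).2 v
    simp only [w, Finset.sum_add_distrib, ← Finset.mul_sum]
    have h2 : ∑ u : G.neighborSet v, p s(v, (u : V)) = 0 := by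
      rw [← hsum0 v, ← Finset.sum_subtype (Finset.univ.filter (G.Adj v)) (by simp)
        (fun u => p s(v, u)), Finset.sum_filter]
      refine Finset.sum_congr rfl fun u _ => ?_
      split_ifs with hu
      · rfl
      · exact (hp0 _ hu).symm
    rw [h2, mul_zero, add_zero]
    convert h1
  have hw : IsFractionalPerfectMatching G w := by
    refine ⟨fun e => ⟨hw0 e, ?_⟩, fun v => by convert hwsum v⟩
    obtain ⟨e, he⟩ := e
    induction e with
    | h a b =>
      rw [← hwsum a]
      exact Finset.single_le_sum
        (f := fun u : G.neighborSet a => w ⟨s(a, (u : V)), G.mem_edgeSet.2 u.2⟩)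
        (fun _ _ => hw0 _) (Finset.mem_univ (⟨b, he⟩ : G.neighborSet a))
  have h1 := congrFun ((hM.2 w).1 hw) ⟨e₀, he₀⟩
  have h2 : 0 < (1 + S)⁻¹ * p e₀ := by positivity
  simp only [w] at h1
  linarith

/-- Alternating reachability is transitive and irreflexive, so the number of predecessors strictly
increases along each step. -/
theorem IsUniqueFractionalPerfectMatching.exists_height {V : Type*} [Fintype V]
    {G : SimpleGraph V} {M : G.Subgraph} (hM : IsUniqueFractionalPerfectMatching G M) :
    ∃ h : V → ℕ, (∀ v, h v ≤ Fintype.card V) ∧ ∀ x v, AltStep G M x v → h x < h v := by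
  refine ⟨fun v => {x | Relation.TransGen (AltStep G M) x v}.ncard, fun v => ?_,
    fun x v hxv => ?_⟩
  · rw [← Nat.card_eq_fintype_card, ← Set.ncard_univ]
    exact Set.ncard_le_ncard (Set.subset_univ _)
  · refine Set.ncard_lt_ncard (Set.ssubset_iff_exists.2 ⟨fun z hz => ?_, x, ?_, ?_⟩)
    · exact Relation.TransGen.tail hz hxv
    · exact Relation.TransGen.single hxv
    · exact hM.not_transGen x

theorem IsUniqueFractionalPerfectMatching.exists_isWeightedPairing {V : Type*} [Fintype V]
    {G : SimpleGraph V} {M : G.Subgraph} (hM : IsUniqueFractionalPerfectMatching G M) :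
    ∃ (G' : SimpleGraph (M.edgeSet × Bool)) (_ : G ≃g G') (p : M.edgeSet × Bool → ℕ) (D : ℕ),
      IsWeightedPairing G' p D := by
  obtain ⟨h, hle, hlt⟩ := hM.exists_height
  have hper := SimpleGraph.Subgraph.isPerfectMatching_iff.1 hM.1
  choose σ hσ huniq using hper
  simp only at hσ huniq
  have hσσ : ∀ v, σ (σ v) = v := fun v => (huniq _ _ (hσ v).symm).symm
  -- The heights cancel on a matching edge. For an edge `uv` outside `M`, the steps from `σ u` to
  -- `v` and from `σ v` to `u` make the sum strictly smaller. The offset prevents truncated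
  -- subtraction.
  let q : V → ℕ := fun v => Fintype.card V + 1 + h (σ v) - h v
  have hq : ∀ v, q v + q (σ v) = 2 * (Fintype.card V + 1) := by
    intro v
    have h1 := hle v
    have h2 := hle (σ v)
    simp only [q, hσσ]
    omega
  have hqlt : ∀ u v, G.Adj u v → ¬ M.Adj u v → q u + q v < 2 * (Fintype.card V + 1) := by
    intro u v huv hMuv
    have h1 := hlt (σ u) v ⟨u, huv.symm, fun h => hMuv h.symm, hσ u⟩
    have h2 := hlt (σ v) u ⟨v, huv, hMuv, hσ v⟩
    have h3 := hle u
    have h4 := hle v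
    simp only [q]
    omega
  have hor : ∀ e : M.edgeSet, ∃ a b, e.1 = s(a, b) ∧ M.Adj a b ∧ q a ≤ q b := by
    rintro ⟨e, he⟩
    induction e with
    | h a b =>
      rcases le_total (q a) (q b) with hab | hab
      · exact ⟨a, b, rfl, he, hab⟩
      · exact ⟨b, a, Sym2.eq_swap, M.adj_symm he, hab⟩
  choose a b hab hadj hqab using hor
  let F : M.edgeSet × Bool → V := fun x => if x.2 then b x.1 else a x.1
  have hF : ∀ x v, M.Adj (F x) v → (x.1 : Sym2 V) = s(F x, v) := by
    rintro ⟨e, s⟩ v hv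
    rw [hab e]
    cases s
    · have hv' : M.Adj (a e) v := hv
      rw [huniq _ _ hv', ← huniq _ _ (hadj e)]
      rfl
    · have hv' : M.Adj (b e) v := hv
      rw [huniq _ _ hv', ← huniq _ _ (hadj e).symm]
      exact Sym2.eq_swap
  have hbij : Function.Bijective F := by
    constructor
    · intro x y hxy
      have h1 := hF x _ (hσ _)
      have h2 := hF y _ (hσ _)
      rw [hxy, ← h2] at h1
      obtain ⟨e, s⟩ := x
      obtain ⟨e', t⟩ := y
      obtain rfl : e = e' := Subtype.ext h1
      have hne := (M.adj_sub (hadj e)).ne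
      cases s <;> cases t
      · rfl
      · exact absurd hxy hne
      · exact absurd hxy.symm hne
      · rfl
    · intro v
      have hv := hab ⟨s(v, σ v), hσ v⟩
      simp only at hv
      have : v ∈ s(a ⟨s(v, σ v), hσ v⟩, b ⟨s(v, σ v), hσ v⟩) := hv ▸ Sym2.mem_mk_left _ _
      rcases Sym2.mem_iff.1 this with h | h
      · exact ⟨(_, false), h.symm⟩
      · exact ⟨(_, true), h.symm⟩
  refine ⟨G.comap F, (SimpleGraph.Iso.comap (Equiv.ofBijective F hbij) G).symm, q ∘ F, _,
    ⟨Nat.mul_pos two_pos (Nat.succ_pos _), fun e => M.adj_sub (hadj e), hqab, fun e => ?_,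
      fun u v huv hne => hqlt _ _ huv fun hM' => hne (Subtype.ext ?_)⟩⟩
  · have := huniq _ _ (hadj e)
    simp only [Function.comp, F]
    simp only [if_true, this, Bool.false_eq_true, if_false]
    exact hq _
  · rw [hF u _ hM', hF v _ hM'.symm, Sym2.eq_swap]

/-! ### The empty graph and paths -/

theorem card_aut_le_eind_of_isEmpty {V : Type*} [Fintype V] [IsEmpty V] (G : SimpleGraph V) :
    (Nat.card (G ≃g G) : ℝ) ≤ eind G := by
  let e : V ≃ Empty × Bool := Equiv.equivOfIsEmpty _ _
  have he : ∀ i : Empty, G.Adj (e.symm (i, false)) (e.symm (i, true)) := fun i => i.elim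
  refine le_eind_of_frequently e he (Filter.Eventually.frequently ?_)
  refine Filter.Eventually.of_forall fun m => ?_
  simp only [Fintype.card_eq_zero, pow_zero, div_one]
  refine le_mul_of_one_le_right (Nat.cast_nonneg _) ?_
  -- A star realises every edge count, and its empty vertex set is an induced copy.
  obtain ⟨H, hH⟩ : ∃ H : SimpleGraph (Option (Fin m)), H.edgeSet.ncard = m := by
    refine ⟨SimpleGraph.fromEdgeSet (Set.range fun i : Fin m => s(none, some i)), ?_⟩
    rw [SimpleGraph.edgeSet_fromEdgeSet, sdiff_eq_left.2, ← Set.image_univ,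
      Set.ncard_image_of_injective, Set.ncard_univ, Nat.card_fin]
    · intro i j h
      simpa using h
    · rw [Set.disjoint_left]
      rintro _ ⟨i, rfl⟩
      simp
  have h1 := inducedCount_le_eindEdges e he H
  rw [hH] at h1
  have h2 : 0 < inducedCount G H :=
    (Set.ncard_pos (Set.toFinite _)).2 ⟨∅, ⟨Equiv.equivOfIsEmpty _ _, fun {a} => isEmptyElim a⟩⟩
  exact_mod_cast h2.trans_le h1

/-- The path on `2 * t` vertices, with its perfect matching made explicit. -/
theorem exists_isWeightedPairing_pathGraph {t : ℕ} (ht : 0 < t) :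
    ∃ (G : SimpleGraph (Fin t × Bool)) (_ : SimpleGraph.pathGraph (2 * t) ≃g G)
      (p : Fin t × Bool → ℕ) (D : ℕ), IsWeightedPairing G p D := by
  let e : Fin t × Bool ≃ Fin (2 * t) :=
    ((Equiv.refl _).prodCongr finTwoEquiv.symm).trans
      (finProdFinEquiv.trans (finCongr (mul_comm t 2)))
  have he : ∀ i s, (e (i, s) : ℕ) = 2 * i + if s then 1 else 0 := by
    intro i s
    cases s <;> simp [e, finTwoEquiv]; omega
  -- Pair `i` has weights `t - i` and `t + i`, so the edge joining pair `i` to pair `i + 1` has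
  -- total `2 * t - 1`.
  refine ⟨(SimpleGraph.pathGraph (2 * t)).comap e, (SimpleGraph.Iso.comap e _).symm,
    fun x => if x.2 then t + x.1 else t - x.1, 2 * t, ⟨?_, ?_, ?_, ?_, ?_⟩⟩
  · omega
  · intro i
    simp [SimpleGraph.pathGraph_adj, he]
  · intro i
    simp only [if_true, Bool.false_eq_true, if_false]
    omega
  · intro i
    simp only [if_true, Bool.false_eq_true, if_false]
    omega
  · rintro ⟨i, s⟩ ⟨j, s'⟩ h hne
    have hne' : (i : ℕ) ≠ j := fun h => hne (Fin.ext h)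
    simp only [SimpleGraph.comap_adj, SimpleGraph.pathGraph_adj, he] at h
    cases s <;> cases s' <;> simp at h ⊢ <;> omega

theorem two_le_card_aut_pathGraph {n : ℕ} (hn : 2 ≤ n) :
    2 ≤ Nat.card (SimpleGraph.pathGraph n ≃g SimpleGraph.pathGraph n) := by
  let r : SimpleGraph.pathGraph n ≃g SimpleGraph.pathGraph n :=
    ⟨Fin.revPerm, by
      intro a b
      simp only [SimpleGraph.pathGraph_adj, Fin.revPerm_apply, Fin.val_rev]
      omega⟩
  have : Nontrivial (SimpleGraph.pathGraph n ≃g SimpleGraph.pathGraph n) := by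
    refine ⟨r, RelIso.refl _, fun h => ?_⟩
    have h1 := congrArg Fin.val (DFunLike.congr_fun h (⟨0, by omega⟩ : Fin n))
    simp [r] at h1
    omega
  have : Finite (SimpleGraph.pathGraph n ≃g SimpleGraph.pathGraph n) :=
    Finite.of_injective (fun f => f.toEquiv) RelIso.toEquiv_injective
  exact Finite.one_lt_card

end EdgeInducibility

theorem theorem1p3 :
    (∀ (V : Type*) [Fintype V] (G : SimpleGraph V) (M : G.Subgraph) (k : ℕ),
      EdgeInducibility.IsUniqueFractionalPerfectMatching G M →
      M.edgeSet.ncard = k → k ≠ 1 →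
      EdgeInducibility.eind G ≥
        (Nat.card (G ≃g G) : ℝ) / (2 ^ k * ((k : ℝ) ^ k - (k : ℝ)))) ∧
    (∀ t : ℕ, 2 ≤ t →
      EdgeInducibility.eind (SimpleGraph.pathGraph (2 * t)) ≥
        1 / (2 ^ (t - 1) * ((t : ℝ) ^ t - (t : ℝ)))) := by
  classical
  refine ⟨fun V _ G M k hM hk hk1 => ?_, fun t ht => ?_⟩
  · obtain ⟨G', e, p, D, hG⟩ := hM.exists_isWeightedPairing
    have hcard : Fintype.card M.edgeSet = k := by
      rw [← Nat.card_eq_fintype_card, Nat.card_coe_set_eq, hk]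
    rcases Nat.lt_or_ge k 2 with h | h
    · obtain rfl : k = 0 := by omega
      have := Fintype.card_eq_zero_iff.1 hcard
      have : IsEmpty V := e.toEquiv.isEmpty
      -- Here `0 ^ 0 = 1` makes the denominator equal to `1`.
      simpa using EdgeInducibility.card_aut_le_eind_of_isEmpty G
    · have := hG.le_eind e (hcard.symm ▸ h)
      rwa [hcard] at this
  · obtain ⟨G', e, p, D, hG⟩ := EdgeInducibility.exists_isWeightedPairing_pathGraph (t := t)
      (by omega)
    have h1 := hG.le_eind e (by simpa using ht)
    rw [Fintype.card_fin] at h1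
    refine le_trans ?_ h1
    have h2 : (2 : ℝ) ≤ Nat.card (SimpleGraph.pathGraph (2 * t) ≃g SimpleGraph.pathGraph (2 * t)) :=
      by exact_mod_cast EdgeInducibility.two_le_card_aut_pathGraph (n := 2 * t) (by omega)
    have h3 : (0 : ℝ) < (t : ℝ) ^ t - t := by
      have ht1 : (1 : ℝ) < t := by exact_mod_cast ht
      have := pow_lt_pow_right₀ ht1 (show 1 < t from ht)
      rw [pow_one] at this
      linarith
    -- The identity and the reversal supply the factor `2` that turns `2 ^ t` into `2 ^ (t - 1)`.
    obtain ⟨s, rfl⟩ : ∃ s, t = s + 1 := ⟨t - 1, by omega⟩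
    rw [Nat.add_sub_cancel, pow_succ (2 : ℝ) s, mul_right_comm,
      ← mul_div_mul_right (1 : ℝ) _ (two_ne_zero (α := ℝ)), one_mul]
    gcongr
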